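/- A metric-measure field ($mm$-field) over a complete separable metric space $(B,d_B)$ is a triple $\mathcal X=(X,\pi_X,\mu_X)$, where $(X,d_X)$ is a complete separable metric space, $\pi_X\colon X\to B$ is $1$-Lipschitz, and $\mu_X$ is a Borel probability measure on $X$; it is bounded if $(X,d_X)$ is a bounded metric space. For an index set $I=\mathbb N$ or $I=\{1,\dots,n\}$ let $\mathcal R_B^I$ be the set of pairs $((r_{ij})_{i,j\in I},(b_i)_{i\in I})$ with $b_i\in B$ and $r_{ij}\in\mathbb R$ satisfying $r_{ij}=r_{ji}$, $r_{ii}=0$ and $r_{ik}\le r_{ij}+r_{jk}$, with the product topology and its Borel $\sigma$-algebra, and put $$\rho\big((r,b),(r',b')\big)=\max\Big\{\tfrac12\sup_{i,j}|r_{ij}-r'_{ij}|,\ \sup_i d_B(b_i,b'_i)\Big\}\in[0,\infty].$$ Let $\mathcal D_{\mathcal X}$ (for $I=\mathbb N$) and $\mathcal D^n_{\mathcal X}$ (for $I=\{1,\dots,n\}$) be the push-forwards of the product measures $\mu_X^{\otimes\mathbb N}$ and $\mu_X^{\otimes n}$ under $(x_i)_{i\in I}\mapsto\big((d_X(x_i,x_j))_{i,j},(\pi_X(x_i))_i\big)$.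 For probability measures $D,D'$ on $\mathcal R_B^I$ let $d_{W,p}(D,D')=\inf_Q\big(\int\rho^p\,dQ\big)^{1/p}$ for $1\le p<\infty$ and $d_{W,\infty}(D,D')=\inf_Q\operatorname{ess\,sup}_Q\rho$, where $Q$ runs over all couplings of $D$ and $D'$. Finally, for $mm$-fields $\mathcal X,\mathcal Y$ over $B$ let $$d_{GW,\infty}(\mathcal X,\mathcal Y)=\inf_P\max\Big\{\tfrac12\sup_{(x,y,x',y')\in\operatorname{supp}(P\otimes P)}|d_X(x,x')-d_Y(y,y')|,\ \sup_{(x,y)\in\operatorname{supp}P}d_B(\pi_X(x),\pi_Y(y))\Big\},$$ where $P$ runs over all couplings of $\mu_X$ and $\mu_Y$. **Theorem.** Let $\mathcal X$ and $\mathcal Y$ be bounded $mm$-fields over $B$. Then, for every $1\le p\le\infty$, $$\lim_{n\to\infty}d_{W,p}(\mathcal D^n_{\mathcal X},\mathcal D^n_{\mathcal Y})=d_{W,p}(\mathcal D_{\mathcal X},\mathcal D_{\mathcal Y})=d_{GW,\infty}(\mathcal X,\mathcal Y)<\infty.$$ -/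

import Mathlib

open MeasureTheory Filter Topology
open scoped ENNReal

/-- A metric-measure field over `B` with domain `X`: a `1`-Lipschitz map `π : X → B` together with
a Borel probability measure on `X`. (That `X` and `B` are complete separable metric spaces is
expressed by instance arguments.) -/
structure MMField (X B : Type*) [MetricSpace X] [MeasurableSpace X] [MetricSpace B] where
  π : X → B
  lipschitz : LipschitzWith 1 π
  μ : ProbabilityMeasure X

/-- `P` is a coupling of `μ` and `ν`: a measure on the product with marginals `μ` and `ν`.
(If `μ` is a probability measure, so is `P`.) -/
def IsCoupling {α β : Type*} [MeasurableSpace α] [MeasurableSpace β]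
    (μ : Measure α) (ν : Measure β) (P : Measure (α × β)) : Prop :=
  P.map Prod.fst = μ ∧ P.map Prod.snd = ν

/-- The `p`-Wasserstein distance with respect to an extended distance function `ρ`, i.e. the
infimum over all couplings `P` of `(∫ ρ ^ p dP) ^ (1 / p)` for finite `p`, and of the `P`-essential
supremum of `ρ` for `p = ∞`. -/
noncomputable def wassersteinDist {α : Type*} [MeasurableSpace α] (ρ : α → α → ℝ≥0∞) (p : ℝ≥0∞)
    (μ ν : Measure α) : ℝ≥0∞ :=
  ⨅ (P : Measure (α × α)) (_ : IsCoupling μ ν P), eLpNorm (fun z : α × α => ρ z.1 z.2) p P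

/-- The space of pseudo-distance matrices indexed by `ι`, with the topology and the measurable
structure of a subspace of the product `ι → ι → ℝ`. -/
abbrev DistMatrix (ι : Type*) : Type _ :=
  {r : ι → ι → ℝ // (∀ i j, r i j = r j i) ∧ (∀ i, r i i = 0) ∧ ∀ i j k, r i k ≤ r i j + r j k}

/-- The space of augmented distance matrices indexed by `ι`: `ι = ℕ` gives the countably infinite
ones, `ι = Fin n` the `n × n` ones. It carries the product topology and σ-algebra. -/
abbrev ADM (ι B : Type*) : Type _ := DistMatrix ι × (ι → B)

/-- The extended distance
`ρ ((r, b), (r', b')) = max (1/2 * sup_{i,j} |r i j - r' i j|) (sup_i d_B (b i) (b' i))`. -/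
noncomputable def ADM.rho {ι B : Type*} [MetricSpace B] (a a' : ADM ι B) : ℝ≥0∞ :=
  max ((1 / 2 : ℝ≥0∞) * ⨆ (i : ι) (j : ι), ENNReal.ofReal |a.1.1 i j - a'.1.1 i j|)
    (⨆ i : ι, ENNReal.ofReal (dist (a.2 i) (a'.2 i)))

namespace MMField

variable {X Y B : Type*} [MetricSpace X] [MeasurableSpace X] [MetricSpace Y] [MeasurableSpace Y]
  [MetricSpace B]

/-- The map sending a family `(x i)` of points to the augmented distance matrix
`(d_X (x i) (x j), π (x i))`. -/
def admMap (𝒳 : MMField X B) (ι : Type*) (x : ι → X) : ADM ι B :=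
  (⟨fun i j => dist (x i) (x j), fun _ _ => dist_comm _ _, fun _ => dist_self _,
    fun _ _ _ => dist_triangle _ _ _⟩, fun i => 𝒳.π (x i))

theorem measurable_admMap [BorelSpace X] [SecondCountableTopology X] [MeasurableSpace B]
    [BorelSpace B] (𝒳 : MMField X B) (ι : Type*) : Measurable (𝒳.admMap ι) := by
  refine Measurable.prodMk (Measurable.subtype_mk ?_) ?_
  · refine measurable_pi_lambda _ fun i => measurable_pi_lambda _ fun j => ?_
    exact (measurable_pi_apply i).dist (measurable_pi_apply j)
  · exact measurable_pi_lambda _ fun i =>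
      𝒳.lipschitz.continuous.measurable.comp (measurable_pi_apply i)

/-- The (countably infinite) augmented distance matrix distribution, the law of the augmented
distance matrix of an i.i.d. sequence with law `μ`. -/
noncomputable def admDist [MeasurableSpace B] (𝒳 : MMField X B) : Measure (ADM ℕ B) :=
  (Measure.infinitePi fun _ : ℕ => (𝒳.μ : Measure X)).map (𝒳.admMap ℕ)

/-- The `n × n` augmented distance matrix distribution. -/
noncomputable def admDistFin [MeasurableSpace B] (𝒳 : MMField X B) (n : ℕ) :
    Measure (ADM (Fin n) B) :=
  (Measure.pi fun _ : Fin n => (𝒳.μ : Measure X)).map (𝒳.admMap (Fin n))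

/-- The Gromov–Wasserstein distance for `p = ∞`: the infimum over all couplings `P` of the maximum
of half the supremum of `|d_X (x, x') - d_Y (y, y')|` over the support of `P ⊗ P` and the supremum
of `d_B (π_X x, π_Y y)` over the support of `P`. -/
noncomputable def gwDistInfty (𝒳 : MMField X B) (𝒴 : MMField Y B) : ℝ≥0∞ :=
  ⨅ (P : Measure (X × Y)) (_ : IsCoupling (𝒳.μ : Measure X) (𝒴.μ : Measure Y) P),
    max ((1 / 2 : ℝ≥0∞) * ⨆ z ∈ (P.prod P).support,
        ENNReal.ofReal |dist z.1.1 z.2.1 - dist z.1.2 z.2.2|)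
      (⨆ z ∈ P.support, ENNReal.ofReal (dist (𝒳.π z.1) (𝒴.π z.2)))

end MMField

/-! Upper bound: sample i.i.d. pairs from a coupling `P` of the two fields. Almost surely all pairs
lie in the support of `P`, so the two matrices are within the cost of `P`; this bounds the
Wasserstein distance for every index set and every `p`. Passing to submatrices only decreases the
distance, so the finite distances lie below the infinite one.

Lower bound: suppose the distance of the finite laws is below `c' < c` for infinitely many `n`. By
Markov, some coupling has `ρ < c` with probability at least `1 - c'/c`. It lifts to a coupling of
sequences of points, and by the law of large numbers and Egorov the empirical measures converge
uniformly off sets of still smaller measure. Hence some pair of sequences is good in both respects.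
The empirical measures of the pairs `(x i, y i)` are then tight, and by Prokhorov a subsequence
converges to a coupling of cost at most `c`. Only positive probability is used, which is why every
`p` yields the same `L^∞` distance. -/

/-! ### Lifting couplings along maps. -/

namespace IsCoupling

variable {α β : Type*} [MeasurableSpace α] [MeasurableSpace β] {μ : Measure α} {ν : Measure β}
  {P : Measure (α × β)}

theorem isProbabilityMeasure [IsProbabilityMeasure μ] (h : IsCoupling μ ν P) :
    IsProbabilityMeasure P := by
  have : IsProbabilityMeasure (P.map Prod.fst) := by rw [h.1]; infer_instance
  exact Measure.isProbabilityMeasure_of_map Prod.fst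

theorem map {α' β' : Type*} [MeasurableSpace α'] [MeasurableSpace β'] (h : IsCoupling μ ν P)
    {f : α → α'} {g : β → β'} (hf : Measurable f) (hg : Measurable g) :
    IsCoupling (μ.map f) (ν.map g) (P.map (Prod.map f g)) := by
  constructor
  · rw [Measure.map_map measurable_fst (hf.prodMap hg), ← h.1, Measure.map_map hf measurable_fst]
    rfl
  · rw [Measure.map_map measurable_snd (hf.prodMap hg), ← h.2, Measure.map_map hg measurable_snd]
    rfl

end IsCoupling

/-- If the first marginal of `Q` is an image of `μ`, then `Q` is an image of a measure with first
marginal `μ`. -/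
theorem exists_map_fst_eq_and_map_prodMap_eq {α A A' : Type*} [MeasurableSpace α]
    [MeasurableSpace A] [MeasurableSpace A'] [StandardBorelSpace A'] [Nonempty A'] {μ : Measure α}
    [IsProbabilityMeasure μ] {f : α → A} (hf : Measurable f) {Q : Measure (A × A')}
    (hQ : Q.map Prod.fst = μ.map f) :
    ∃ Q' : Measure (α × A'), Q'.map Prod.fst = μ ∧ Q'.map (Prod.map f id) = Q := by
  have : IsProbabilityMeasure (Q.map Prod.fst) := by
    rw [hQ]; exact Measure.isProbabilityMeasure_map hf.aemeasurable
  have : IsProbabilityMeasure Q :=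
    Measure.isProbabilityMeasure_of_map Prod.fst
  -- Draw `a` from `μ`, then the second coordinate from the conditional law of `Q` given `f a`.
  refine ⟨μ.compProd (Q.condKernel.comap f hf), Measure.fst_compProd _ _, ?_⟩
  have : IsProbabilityMeasure ((μ.compProd (Q.condKernel.comap f hf)).map (Prod.map f id)) :=
    Measure.isProbabilityMeasure_map (hf.prodMap measurable_id).aemeasurable
  refine Measure.ext_prod fun {s t} hs ht => ?_
  conv_rhs => rw [← Q.disintegrate Q.condKernel, Measure.compProd_apply_prod hs ht]
  rw [Measure.map_apply (hf.prodMap measurable_id) (hs.prod ht), Set.preimage_prod_map_prod,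
    Measure.compProd_apply_prod (hf hs) (measurable_id ht), Measure.fst, hQ,
    setLIntegral_map hs (ProbabilityTheory.Kernel.measurable_coe _ ht) hf]
  rfl

/-- Every coupling of two image measures is the image of a coupling. -/
theorem IsCoupling.exists_map_eq {α β A A' : Type*} [MeasurableSpace α] [MeasurableSpace β]
    [MeasurableSpace A] [MeasurableSpace A'] [StandardBorelSpace A'] [StandardBorelSpace α]
    {μ : Measure α} {ν : Measure β} [IsProbabilityMeasure μ] [IsProbabilityMeasure ν]
    {f : α → A} {g : β → A'} (hf : Measurable f) (hg : Measurable g) {Q : Measure (A × A')}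
    (hQ : IsCoupling (μ.map f) (ν.map g) Q) :
    ∃ Q' : Measure (α × β), IsCoupling μ ν Q' ∧ Q'.map (Prod.map f g) = Q := by
  have : Nonempty α := nonempty_of_isProbabilityMeasure μ
  have : Nonempty β := nonempty_of_isProbabilityMeasure ν
  have : Nonempty A' := ‹Nonempty β›.map g
  obtain ⟨R, hR₁, hR₂⟩ := exists_map_fst_eq_and_map_prodMap_eq hf hQ.1
  -- After a swap the other factor comes first, and the same lemma lifts it.
  have hR : (R.map Prod.swap).map Prod.fst = ν.map g := by
    rw [Measure.map_map measurable_fst measurable_swap, ← hQ.2, ← hR₂,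
      Measure.map_map measurable_snd (hf.prodMap measurable_id)]
    rfl
  obtain ⟨S, hS₁, hS₂⟩ := exists_map_fst_eq_and_map_prodMap_eq hg hR
  refine ⟨S.map Prod.swap, ⟨?_, ?_⟩, ?_⟩
  · rw [Measure.map_map measurable_fst measurable_swap, ← hR₁]
    have := congrArg (Measure.map Prod.snd) hS₂
    rw [Measure.map_map measurable_snd (hg.prodMap measurable_id),
      Measure.map_map measurable_snd measurable_swap] at this
    exact this
  · rw [Measure.map_map measurable_snd measurable_swap, ← hS₁]
    rfl
  · have := congrArg (fun M => (M.map Prod.swap).map (Prod.map f id)) hS₂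
    rw [Measure.map_map measurable_swap measurable_swap, Prod.swap_swap_eq, Measure.map_id, hR₂,
      Measure.map_map measurable_swap (hg.prodMap measurable_id),
      Measure.map_map (hf.prodMap measurable_id)
        (measurable_swap.comp (hg.prodMap measurable_id))] at this
    rw [Measure.map_map (hf.prodMap hg) measurable_swap, ← this]
    rfl

/-! ### Uniform convergence of empirical measures. -/

section Empirical

variable {X : Type*} [MeasurableSpace X]

/-- The uniform distribution on the first `n + 1` terms of a sequence. -/
noncomputable def empiricalMeasure (n : ℕ) (x : ℕ → X) : ProbabilityMeasure X :=
  ⟨(ProbabilityTheory.uniformOn (Set.univ : Set (Fin (n + 1)))).map fun i : Fin (n + 1) => x i,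
    Measure.isProbabilityMeasure_map (measurable_of_finite _).aemeasurable⟩

theorem toMeasure_empiricalMeasure (n : ℕ) (x : ℕ → X) :
    (empiricalMeasure n x : Measure X) =
      (ProbabilityTheory.uniformOn (Set.univ : Set (Fin (n + 1)))).map fun i : Fin (n + 1) => x i :=
  rfl

theorem empiricalMeasure_map {Y : Type*} [MeasurableSpace Y] (n : ℕ) (x : ℕ → X) {f : X → Y}
    (hf : Measurable f) :
    (empiricalMeasure n x : Measure X).map f = empiricalMeasure n (fun i => f (x i)) := by
  rw [toMeasure_empiricalMeasure, toMeasure_empiricalMeasure, Measure.map_map hf (measurable_of_finite _)]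
  rfl

theorem empiricalMeasure_apply_eq_one {n : ℕ} {x : ℕ → X} {s : Set X} (hs : MeasurableSet s)
    (h : ∀ i ≤ n, x i ∈ s) : (empiricalMeasure n x : Measure X) s = 1 := by
  rw [toMeasure_empiricalMeasure, Measure.map_apply (measurable_of_finite _) hs]
  have : (fun i : Fin (n + 1) => x i) ⁻¹' s = Set.univ :=
    Set.eq_univ_of_forall fun i => h i (Nat.lt_succ_iff.1 i.2)
  rw [this]
  exact measure_univ

theorem empiricalMeasure_real_apply (n : ℕ) (x : ℕ → X) {s : Set X} (hs : MeasurableSet s) :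
    (empiricalMeasure n x : Measure X).real s =
      (∑ i ∈ Finset.range (n + 1), s.indicator (fun _ => (1 : ℝ)) (x i)) / (n + 1 : ℕ) := by
  classical
  rw [toMeasure_empiricalMeasure, map_measureReal_apply (measurable_of_finite _) hs, Measure.real]
  rw [ProbabilityTheory.uniformOn_univ, ENNReal.toReal_div, Fintype.card_fin,
    ENNReal.toReal_natCast, Finset.sum_range]
  congr 1
  rw [← Set.coe_toFinset ((fun i : Fin (n + 1) => x i) ⁻¹' s), Measure.count_apply_finset,
    ENNReal.toReal_natCast]
  simp only [Set.indicator_apply, Finset.sum_boole]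
  congr 2
  ext i
  simp

/-- The law of large numbers for the empirical measures of a set. -/
theorem ae_tendsto_empiricalMeasure_real (μ : Measure X) [IsProbabilityMeasure μ] {s : Set X}
    (hs : MeasurableSet s) :
    ∀ᵐ x ∂Measure.infinitePi (fun _ : ℕ => μ),
      Tendsto (fun n => (empiricalMeasure n x : Measure X).real s) atTop (𝓝 (μ.real s)) := by
  have hm : Measurable (s.indicator fun _ => (1 : ℝ)) := measurable_const.indicator hs
  have key := ProbabilityTheory.strong_law_ae_real (μ := Measure.infinitePi (fun _ : ℕ => μ))
    (fun i x => s.indicator (fun _ => (1 : ℝ)) (x i))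
    ((measurePreserving_eval_infinitePi (fun _ : ℕ => μ) 0).integrable_comp_of_integrable
      ((integrable_const 1).indicator hs))
    (fun i j hij => (ProbabilityTheory.iIndepFun_infinitePi (P := fun _ : ℕ => μ)
      (X := fun _ => s.indicator fun _ => (1 : ℝ)) fun _ => hm).indepFun hij)
    (fun i => ⟨(hm.comp (measurable_pi_apply i)).aemeasurable,
      (hm.comp (measurable_pi_apply 0)).aemeasurable, by
        have h (k : ℕ) := Measure.map_map (μ := Measure.infinitePi (fun _ : ℕ => μ)) hm
          (measurable_pi_apply k)
        simp only [Measure.infinitePi_map_eval] at h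
        exact (h i).symm.trans (h 0)⟩)
  filter_upwards [key] with x hx
  have hint : ∫ y : ℕ → X, s.indicator (fun _ => (1 : ℝ)) (y 0)
      ∂(Measure.infinitePi fun _ => μ) = μ.real s := by
    have h := integral_map (μ := Measure.infinitePi fun _ : ℕ => μ) (φ := Function.eval 0)
      (measurable_pi_apply 0).aemeasurable hm.aestronglyMeasurable
    rw [(measurePreserving_eval_infinitePi (fun _ : ℕ => μ) 0).map_eq] at h
    exact h.symm.trans (integral_indicator_one hs)
  rw [hint] at hx
  refine Tendsto.congr (fun n => (empiricalMeasure_real_apply n x hs).symm) ?_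
  -- The strong law averages `n` terms, `empiricalMeasure n` averages `n + 1`.
  exact (tendsto_add_atTop_iff_nat 1).2 hx

theorem measurable_empiricalMeasure_real (n : ℕ) {s : Set X} (hs : MeasurableSet s) :
    Measurable fun x : ℕ → X => (empiricalMeasure n x : Measure X).real s := by
  simp only [empiricalMeasure_real_apply _ _ hs]
  exact (Finset.measurable_sum _ fun i _ =>
    (measurable_const.indicator hs).comp (measurable_pi_apply i)).div_const _

/-- Outside a set of small measure, the empirical measures of countably many sets converge
uniformly. -/
theorem exists_measure_le_and_tendsto_empiricalMeasure_real (μ : Measure X) [IsProbabilityMeasure μ]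
    {𝒞 : Set (Set X)} (h𝒞 : 𝒞.Countable) (hm : ∀ s ∈ 𝒞, MeasurableSet s) {δ : ℝ≥0∞} (hδ : δ ≠ 0) :
    ∃ T : Set (ℕ → X), Measure.infinitePi (fun _ : ℕ => μ) T ≤ δ ∧
      ∀ (x : ℕ → ℕ → X) (φ : ℕ → ℕ), (∀ k, x k ∉ T) → Tendsto φ atTop atTop → ∀ s ∈ 𝒞,
        Tendsto (fun k => (empiricalMeasure (φ k) (x k) : Measure X).real s) atTop
          (𝓝 (μ.real s)) := by
  have := h𝒞.to_subtype
  -- Egorov is applied to each set `s` with exceptional measure `ε s`, and these sum to less than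
  -- `δ`. Uniformity lets the sequence `x k` vary with `k`.
  obtain ⟨ε, hε, hsum⟩ := ENNReal.exists_pos_sum_of_countable hδ 𝒞
  have h (s : 𝒞) := tendstoUniformlyOn_of_ae_tendsto' (μ := Measure.infinitePi (fun _ : ℕ => μ))
    (fun n => (measurable_empiricalMeasure_real n (hm s s.2)).stronglyMeasurable)
    stronglyMeasurable_const (ae_tendsto_empiricalMeasure_real μ (hm s s.2))
    (NNReal.coe_pos.2 (hε s))
  choose t _ ht hunif using h
  refine ⟨⋃ s, t s, (measure_iUnion_le _).trans ?_, fun x φ hx hφ s hs => ?_⟩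
  · simp only [ENNReal.ofReal_coe_nnreal] at ht
    exact (ENNReal.tsum_le_tsum ht).trans hsum.le
  · rw [Metric.tendsto_nhds]
    intro r hr
    filter_upwards [hφ.eventually (Metric.tendstoUniformlyOn_iff.1 (hunif ⟨s, hs⟩) r hr)] with k hk
    rw [dist_comm]
    exact hk (x k) fun hxt => hx k (Set.mem_iUnion.2 ⟨_, hxt⟩)

/-- Outside a set of small measure, the empirical measures converge weakly, uniformly in the
sequence, and are tight. -/
theorem exists_measure_le_and_tendsto_empiricalMeasure [TopologicalSpace X] [PolishSpace X]
    [BorelSpace X] (μ : ProbabilityMeasure X) {δ : ℝ≥0∞} (hδ : δ ≠ 0) :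
    ∃ T : Set (ℕ → X), Measure.infinitePi (fun _ : ℕ => (μ : Measure X)) T ≤ δ ∧
      ∀ (x : ℕ → ℕ → X) (φ : ℕ → ℕ), (∀ k, x k ∉ T) → Tendsto φ atTop atTop →
        Tendsto (fun k => empiricalMeasure (φ k) (x k)) atTop (𝓝 μ) ∧
        IsTightMeasureSet (Set.range fun k => (empiricalMeasure (φ k) (x k) : Measure X)) := by
  have hcpt (m : ℕ) : ∃ K : Set X, IsCompact K ∧ (μ : Measure X) Kᶜ ≤ (m + 1 : ℝ≥0∞)⁻¹ := by
    obtain ⟨K, hK, h⟩ := isTightMeasureSet_iff_exists_isCompact_measure_compl_le.1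
      (isTightMeasureSet_singleton (μ := (μ : Measure X))) (m + 1 : ℝ≥0∞)⁻¹ (by simp)
    exact ⟨K, hK, h _ rfl⟩
  choose K hK hKμ using hcpt
  let b := TopologicalSpace.countableBasis X
  -- A countable π-system containing small neighbourhoods of every point: convergence on it implies
  -- weak convergence.
  let S : Set (Set X) := (fun f => ⋂₀ f) '' {f : Set (Set X) | f.Finite ∧ f ⊆ b}
  have hb := TopologicalSpace.isBasis_countableBasis X
  have hSc : S.Countable :=
    (Set.countable_ofPred_finite_subset (TopologicalSpace.countable_countableBasis X)).image _
  have hSm : ∀ s ∈ S, MeasurableSet s := by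
    rintro _ ⟨f, ⟨hf, hfb⟩, rfl⟩
    exact .sInter hf.countable fun u hu => (hb.isOpen (hfb hu)).measurableSet
  have hSpi : IsPiSystem S := by
    rintro _ ⟨f, ⟨hf, hfb⟩, rfl⟩ _ ⟨g, ⟨hg, hgb⟩, rfl⟩ -
    exact ⟨f ∪ g, ⟨hf.union hg, Set.union_subset hfb hgb⟩, Set.sInter_union f g⟩
  have hSn : ∀ u : Set X, IsOpen u → ∀ x ∈ u, ∃ s ∈ S, s ∈ 𝓝 x ∧ s ⊆ u := by
    intro u hu x hx
    obtain ⟨v, hv, hxv, hvu⟩ := hb.exists_subset_of_mem_open hx hu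
    exact ⟨v, ⟨{v}, ⟨Set.finite_singleton v, by simpa using hv⟩, Set.sInter_singleton v⟩,
      (hb.isOpen hv).mem_nhds hxv, hvu⟩
  -- The complements of the compacts `K m` join the family in order to give tightness.
  obtain ⟨T, hT, hconv⟩ := exists_measure_le_and_tendsto_empiricalMeasure_real (μ : Measure X)
    (𝒞 := S ∪ Set.range fun m => (K m)ᶜ) (hSc.union (Set.countable_range _))
    (by
      rintro s (hs | ⟨m, rfl⟩)
      · exact hSm s hs
      · exact (hK m).measurableSet.compl) hδ
  refine ⟨T, hT, fun x φ hx hφ => ⟨?_, ?_⟩⟩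
  · refine hSpi.tendsto_probabilityMeasure_of_tendsto_of_mem hSm hSn fun s hs => ?_
    rw [← NNReal.tendsto_coe]
    exact hconv x φ hx hφ s (Or.inl hs)
  · rw [isTightMeasureSet_iff_exists_isCompact_measure_compl_le]
    intro ε hε
    obtain ⟨m, hm⟩ := ENNReal.exists_inv_nat_lt hε.ne'
    have hlt : (μ : Measure X) (K m)ᶜ < ε := by
      refine (hKμ m).trans_lt (lt_of_le_of_lt ?_ hm)
      exact ENNReal.inv_le_inv.2 (by simp)
    have hev : ∀ᶠ k in atTop, (empiricalMeasure (φ k) (x k) : Measure X) (K m)ᶜ ≤ ε := by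
      have := hconv x φ hx hφ _ (Or.inr ⟨m, rfl⟩)
      have := (ENNReal.tendsto_toReal_iff (fun _ => measure_ne_top _ _) (measure_ne_top _ _)).1 this
      exact (this.eventually (gt_mem_nhds hlt)).mono fun _ h => h.le
    obtain ⟨N, hN⟩ := eventually_atTop.1 hev
    -- The finitely many measures before `N` are tight individually.
    have (k : ℕ) := isTightMeasureSet_iff_exists_isCompact_measure_compl_le.1
      (isTightMeasureSet_singleton (μ := (empiricalMeasure (φ k) (x k) : Measure X))) ε hε
    choose L hL hLε using this
    refine ⟨K m ∪ ⋃ k ∈ Finset.range N, L k,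
      (hK m).union ((Finset.range N).isCompact_biUnion fun k _ => hL k), ?_⟩
    rintro _ ⟨k, rfl⟩
    rcases lt_or_ge k N with hk | hk
    · refine (measure_mono (Set.compl_subset_compl.2 ?_)).trans (hLε k _ rfl)
      exact (Set.subset_biUnion_of_mem (u := L) (Finset.mem_coe.2 (Finset.mem_range.2 hk))).trans
        Set.subset_union_right
    · exact (measure_mono (Set.compl_subset_compl.2 Set.subset_union_left)).trans (hN k hk)

end Empirical

/-! ### Augmented distance matrices. -/

section ADM

variable {ι B : Type*}

instance [Countable ι] : StandardBorelSpace (DistMatrix ι) := by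
  have hc : IsClosed {r : ι → ι → ℝ | (∀ i j, r i j = r j i) ∧ (∀ i, r i i = 0) ∧
      ∀ i j k, r i k ≤ r i j + r j k} := by
    simp only [Set.ofPred_and, Set.ofPred_forall]
    refine IsClosed.inter ?_ (IsClosed.inter ?_ ?_)
    · exact isClosed_iInter fun i => isClosed_iInter fun j =>
        isClosed_eq (by fun_prop) (by fun_prop)
    · exact isClosed_iInter fun i => isClosed_eq (by fun_prop) (by fun_prop)
    · exact isClosed_iInter fun i => isClosed_iInter fun j => isClosed_iInter fun k =>
        isClosed_le (by fun_prop) (by fun_prop)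
  exact hc.measurableSet.standardBorel

/-- Reindexing of augmented distance matrices. -/
def ADM.reindex {κ : Type*} (e : κ → ι) (a : ADM ι B) : ADM κ B :=
  (⟨fun i j => a.1.1 (e i) (e j), fun _ _ => a.1.2.1 _ _, fun _ => a.1.2.2.1 _,
    fun _ _ _ => a.1.2.2.2 _ _ _⟩, fun i => a.2 (e i))

theorem ADM.measurable_reindex {κ : Type*} (e : κ → ι) [MeasurableSpace B] :
    Measurable (ADM.reindex e : ADM ι B → ADM κ B) := by
  refine Measurable.prodMk (Measurable.subtype_mk ?_) ?_
  · exact measurable_pi_lambda _ fun i => measurable_pi_lambda _ fun j =>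
      (measurable_pi_apply (e j)).comp
        ((measurable_pi_apply (e i)).comp (measurable_subtype_coe.comp measurable_fst))
  · exact measurable_pi_lambda _ fun i => (measurable_pi_apply (e i)).comp measurable_snd

variable [MetricSpace B]

theorem ADM.rho_le_iff {a a' : ADM ι B} {c : ℝ≥0∞} :
    ADM.rho a a' ≤ c ↔ (∀ i j, (1 / 2 : ℝ≥0∞) * ENNReal.ofReal |a.1.1 i j - a'.1.1 i j| ≤ c) ∧
      ∀ i, ENNReal.ofReal (dist (a.2 i) (a'.2 i)) ≤ c := by
  simp only [ADM.rho, max_le_iff, ENNReal.mul_iSup, iSup_le_iff]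

theorem ADM.measurable_rho [Countable ι] [SecondCountableTopology B] [MeasurableSpace B]
    [BorelSpace B] : Measurable fun z : ADM ι B × ADM ι B => ADM.rho z.1 z.2 := by
  have h₁ (i j : ι) : Measurable fun a : ADM ι B => a.1.1 i j :=
    (measurable_pi_apply j).comp
      ((measurable_pi_apply i).comp (measurable_subtype_coe.comp measurable_fst))
  have h₂ (i : ι) : Measurable fun a : ADM ι B => a.2 i :=
    (measurable_pi_apply i).comp measurable_snd
  refine Measurable.max (Measurable.const_mul (.iSup fun i => .iSup fun j => ?_) _)
    (.iSup fun i => ?_)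
  · exact (((h₁ i j).comp measurable_fst).sub ((h₁ i j).comp measurable_snd)).abs.ennreal_ofReal
  · exact (((h₂ i).comp measurable_fst).dist ((h₂ i).comp measurable_snd)).ennreal_ofReal

theorem ADM.rho_reindex_le {κ : Type*} (e : κ → ι) (a a' : ADM ι B) :
    ADM.rho (a.reindex e) (a'.reindex e) ≤ ADM.rho a a' := by
  have h := ADM.rho_le_iff.1 (le_refl (ADM.rho a a'))
  exact ADM.rho_le_iff.2 ⟨fun i j => h.1 (e i) (e j), fun i => h.2 (e i)⟩

end ADM

theorem MeasureTheory.Measure.mk_mem_support_prod {X Y : Type*} [TopologicalSpace X]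
    [TopologicalSpace Y] [MeasurableSpace X] [MeasurableSpace Y] {μ : Measure X} {ν : Measure Y}
    [SFinite ν] {x : X} {y : Y} (hx : x ∈ μ.support) (hy : y ∈ ν.support) :
    (x, y) ∈ (μ.prod ν).support := by
  rw [Measure.mem_support_iff_forall] at hx hy ⊢
  intro U hU
  obtain ⟨V, hV, W, hW, hVW⟩ := mem_nhds_prod_iff.1 hU
  refine lt_of_lt_of_le ?_ (measure_mono hVW)
  rw [Measure.prod_prod]
  exact ENNReal.mul_pos (hx V hV).ne' (hy W hW).ne'

/-! ### Laws of augmented distance matrices. -/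

namespace MMField

variable {X Y B : Type*} [MetricSpace X] [MeasurableSpace X] [MetricSpace Y] [MeasurableSpace Y]
  [MetricSpace B]

/-- The augmented distance matrix distribution for an arbitrary index set. -/
noncomputable def admLaw [MeasurableSpace B] (𝒳 : MMField X B) (ι : Type*) : Measure (ADM ι B) :=
  (Measure.infinitePi fun _ : ι => (𝒳.μ : Measure X)).map (𝒳.admMap ι)

theorem admDistFin_eq_admLaw [MeasurableSpace B] (𝒳 : MMField X B) (n : ℕ) :
    𝒳.admDistFin n = 𝒳.admLaw (Fin n) := by
  rw [admLaw, Measure.infinitePi_eq_pi, admDistFin]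

/-- Injectivity keeps the selected points independent. -/
theorem map_reindex_admLaw [BorelSpace X] [SecondCountableTopology X] [MeasurableSpace B]
    [BorelSpace B] (𝒳 : MMField X B) {ι κ : Type*} {e : κ → ι} (he : Function.Injective e) :
    (𝒳.admLaw ι).map (ADM.reindex e) = 𝒳.admLaw κ := by
  rw [admLaw, admLaw, Measure.map_map (ADM.measurable_reindex e) (𝒳.measurable_admMap ι),
    ← Measure.map_infinitePi_infinitePi_of_inj (P := fun _ : ι => (𝒳.μ : Measure X)) he,
    Measure.map_map (𝒳.measurable_admMap κ) (by fun_prop)]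
  rfl

/-- The product coupling already has finite cost; the Lipschitz condition bounds the part in `B`. -/
theorem gwDistInfty_lt_top (𝒳 : MMField X B) (𝒴 : MMField Y B)
    (hX : Bornology.IsBounded (Set.univ : Set X)) (hY : Bornology.IsBounded (Set.univ : Set Y)) :
    𝒳.gwDistInfty 𝒴 < ∞ := by
  obtain ⟨C, hC⟩ := Metric.isBounded_iff.1 hX
  obtain ⟨D, hD⟩ := Metric.isBounded_iff.1 hY
  obtain ⟨x₀⟩ := nonempty_of_isProbabilityMeasure (𝒳.μ : Measure X)
  obtain ⟨y₀⟩ := nonempty_of_isProbabilityMeasure (𝒴.μ : Measure Y)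
  refine (iInf₂_le ((𝒳.μ : Measure X).prod (𝒴.μ : Measure Y))
    ⟨by simp, by simp⟩).trans_lt (max_lt ?_ ?_)
  · refine ENNReal.mul_lt_top (by simp) (lt_of_le_of_lt (iSup₂_le fun z _ =>
      ENNReal.ofReal_le_ofReal (q := C + D) ?_) ENNReal.ofReal_lt_top)
    have h₁ := hC (Set.mem_univ z.1.1) (Set.mem_univ z.2.1)
    have h₂ := hD (Set.mem_univ z.1.2) (Set.mem_univ z.2.2)
    rw [abs_le]
    constructor <;> linarith [dist_nonneg (x := z.1.1) (y := z.2.1),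
      dist_nonneg (x := z.1.2) (y := z.2.2)]
  · refine lt_of_le_of_lt (iSup₂_le fun z _ =>
      ENNReal.ofReal_le_ofReal (q := C + dist (𝒳.π x₀) (𝒴.π y₀) + D) ?_) ENNReal.ofReal_lt_top
    have h₁ := (𝒳.lipschitz.dist_le_mul z.1 x₀).trans
      (by simpa using hC (Set.mem_univ z.1) (Set.mem_univ x₀))
    have h₂ := (𝒴.lipschitz.dist_le_mul y₀ z.2).trans
      (by simpa using hD (Set.mem_univ y₀) (Set.mem_univ z.2))
    exact (dist_triangle4 _ (𝒳.π x₀) (𝒴.π y₀) _).trans (by gcongr)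

/-! ### Upper bound and monotonicity. -/

section Upper

variable [BorelSpace X] [SecondCountableTopology X] [BorelSpace Y] [SecondCountableTopology Y]
  [MeasurableSpace B] [BorelSpace B] [SecondCountableTopology B]

theorem wassersteinDist_admLaw_mono (𝒳 : MMField X B) (𝒴 : MMField Y B) (p : ℝ≥0∞)
    {ι κ : Type*} [Countable ι] [Countable κ] {e : κ → ι} (he : Function.Injective e) :
    wassersteinDist ADM.rho p (𝒳.admLaw κ) (𝒴.admLaw κ) ≤
      wassersteinDist ADM.rho p (𝒳.admLaw ι) (𝒴.admLaw ι) := by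
  refine le_iInf₂ fun Q hQ => ?_
  have hm := ADM.measurable_reindex (B := B) e
  have hQ' := hQ.map hm hm
  rw [map_reindex_admLaw 𝒳 he, map_reindex_admLaw 𝒴 he] at hQ'
  refine (iInf₂_le _ hQ').trans ?_
  rw [eLpNorm_map_measure ADM.measurable_rho.aestronglyMeasurable (hm.prodMap hm).aemeasurable]
  exact eLpNorm_mono_enorm fun z => ADM.rho_reindex_le e z.1 z.2

theorem wassersteinDist_admLaw_le_gwDistInfty (𝒳 : MMField X B) (𝒴 : MMField Y B) (p : ℝ≥0∞)
    (ι : Type*) [Countable ι] :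
    wassersteinDist ADM.rho p (𝒳.admLaw ι) (𝒴.admLaw ι) ≤ 𝒳.gwDistInfty 𝒴 := by
  refine le_iInf₂ fun P hP => ?_
  have hPp := hP.isProbabilityMeasure
  set c : ℝ≥0∞ := max ((1 / 2 : ℝ≥0∞) * ⨆ z ∈ (P.prod P).support,
    ENNReal.ofReal |dist z.1.1 z.2.1 - dist z.1.2 z.2.2|)
    (⨆ z ∈ P.support, ENNReal.ofReal (dist (𝒳.π z.1) (𝒴.π z.2)))
  -- The law of an i.i.d. family of pairs from `P`, split into two families.
  let R : Measure ((ι → X) × (ι → Y)) :=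
    (Measure.infinitePi fun _ : ι => P).map fun z => (fun i => (z i).1, fun i => (z i).2)
  have hRm : Measurable fun z : ι → X × Y => ((fun i => (z i).1, fun i => (z i).2) :
    (ι → X) × (ι → Y)) := by fun_prop
  have hR : IsCoupling (Measure.infinitePi fun _ : ι => (𝒳.μ : Measure X))
      (Measure.infinitePi fun _ : ι => (𝒴.μ : Measure Y)) R := by
    constructor
    · rw [Measure.map_map measurable_fst hRm]
      simp_rw [← hP.1]
      exact Measure.infinitePi_map_pi (fun _ : ι => P) fun _ => measurable_fst
    · rw [Measure.map_map measurable_snd hRm]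
      simp_rw [← hP.2]
      exact Measure.infinitePi_map_pi (fun _ : ι => P) fun _ => measurable_snd
  have hQ := hR.map (𝒳.measurable_admMap ι) (𝒴.measurable_admMap ι)
  have hRp := hR.isProbabilityMeasure
  have hQp := Measure.isProbabilityMeasure_map (μ := R)
    ((𝒳.measurable_admMap ι).prodMap (𝒴.measurable_admMap ι)).aemeasurable
  refine (iInf₂_le _ hQ).trans ?_
  refine (eLpNorm_le_of_ae_enorm_bound (C := c) ?_).trans (by simp)
  have hmm := (𝒳.measurable_admMap ι).prodMap (𝒴.measurable_admMap ι)
  simp only [enorm_eq_self]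
  rw [ae_map_iff hmm.aemeasurable (measurableSet_le ADM.measurable_rho measurable_const)]
  refine (ae_map_iff hRm.aemeasurable
    (measurableSet_le (ADM.measurable_rho.comp hmm) measurable_const)).2 ?_
  have hsupp : ∀ᵐ z ∂Measure.infinitePi fun _ : ι => P, ∀ i, z i ∈ P.support :=
    ae_all_iff.2 fun i =>
      (measurePreserving_eval_infinitePi (fun _ : ι => P) i).quasiMeasurePreserving.ae
        Measure.support_mem_ae
  filter_upwards [hsupp] with z hz
  refine ADM.rho_le_iff.2 ⟨fun i j => le_max_of_le_left ?_, fun i => le_max_of_le_right ?_⟩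
  · gcongr
    exact le_iSup₂_of_le (z i, z j) (Measure.mk_mem_support_prod (hz i) (hz j)) le_rfl
  · exact le_iSup₂_of_le (z i) (hz i) le_rfl

end Upper

/-! ### Lower bound by compactness. -/

section Lower

variable [SecondCountableTopology X] [BorelSpace X] [SecondCountableTopology Y] [BorelSpace Y]

/-- A tight sequence of measures with small distortion, whose marginals converge to those of the
fields, bounds the Gromov–Wasserstein distance. -/
theorem gwDistInfty_le_of_isTightMeasureSet (𝒳 : MMField X B) (𝒴 : MMField Y B) {c : ℝ≥0∞}
    {P : ℕ → ProbabilityMeasure (X × Y)}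
    (ht : IsTightMeasureSet (Set.range fun k => (P k : Measure (X × Y))))
    (hfst : Tendsto (fun k => (P k).map measurable_fst.aemeasurable) atTop (𝓝 𝒳.μ))
    (hsnd : Tendsto (fun k => (P k).map measurable_snd.aemeasurable) atTop (𝓝 𝒴.μ))
    (hdist : ∀ k, ∀ᵐ z ∂(P k : Measure (X × Y)).prod (P k : Measure (X × Y)),
      (1 / 2 : ℝ≥0∞) * ENNReal.ofReal |dist z.1.1 z.2.1 - dist z.1.2 z.2.2| ≤ c)
    (hπ : ∀ k, ∀ᵐ z ∂(P k : Measure (X × Y)), ENNReal.ofReal (dist (𝒳.π z.1) (𝒴.π z.2)) ≤ c) :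
    𝒳.gwDistInfty 𝒴 ≤ c := by
  -- Portmanteau: a closed set of full measure along the sequence keeps full measure in the limit,
  -- hence contains its support.
  have hcl {Z : Type _} [TopologicalSpace Z] [MeasurableSpace Z] [BorelSpace Z]
      [HasOuterApproxClosed Z] {R : ℕ → ProbabilityMeasure Z} {S : ProbabilityMeasure Z}
      (hRS : Tendsto R atTop (𝓝 S)) {F : Set Z} (hF : IsClosed F)
      (hRF : ∀ k, F ∈ ae (R k : Measure Z)) : (S : Measure Z).support ⊆ F := by
    refine Measure.support_subset_of_isClosed hF ?_
    rw [mem_ae_iff_prob_eq_one hF.measurableSet]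
    refine le_antisymm prob_le_one ?_
    refine le_trans ?_ (ProbabilityMeasure.limsup_measure_closed_le_of_tendsto hRS hF)
    have (k : ℕ) : (R k : Measure Z) F = 1 := (mem_ae_iff_prob_eq_one hF.measurableSet).1 (hRF k)
    simp [this]
  have hcomp : IsCompact (closure (Set.range P)) :=
    isCompact_closure_of_isTightMeasureSet (by simpa [Set.range] using ht)
  obtain ⟨P₀, -, ψ, hψ, hlim⟩ := hcomp.tendsto_subseq fun k => subset_closure (Set.mem_range_self k)
  have h₁ : P₀.map measurable_fst.aemeasurable = 𝒳.μ :=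
    tendsto_nhds_unique
      (ProbabilityMeasure.tendsto_map_of_tendsto_of_continuous _ _ hlim continuous_fst)
      (hfst.comp hψ.tendsto_atTop)
  have h₂ : P₀.map measurable_snd.aemeasurable = 𝒴.μ :=
    tendsto_nhds_unique
      (ProbabilityMeasure.tendsto_map_of_tendsto_of_continuous _ _ hlim continuous_snd)
      (hsnd.comp hψ.tendsto_atTop)
  have hP₀ : IsCoupling (𝒳.μ : Measure X) (𝒴.μ : Measure Y) (P₀ : Measure (X × Y)) :=
    ⟨congrArg Subtype.val h₁, congrArg Subtype.val h₂⟩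
  refine (iInf₂_le _ hP₀).trans (max_le ?_ ?_)
  · simp only [ENNReal.mul_iSup]
    have hlim₂ : Tendsto (fun k => (P (ψ k)).prod (P (ψ k))) atTop (𝓝 (P₀.prod P₀)) :=
      (ProbabilityMeasure.continuous_prod.tendsto (P₀, P₀)).comp (hlim.prodMk_nhds hlim)
    have := hcl hlim₂ (F := {z | (1 / 2 : ℝ≥0∞) *
      ENNReal.ofReal |dist z.1.1 z.2.1 - dist z.1.2 z.2.2| ≤ c})
      (isClosed_le (ENNReal.continuous_const_mul (by simp) |>.comp
        (ENNReal.continuous_ofReal.comp (by fun_prop))) continuous_const) fun k => hdist (ψ k)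
    exact iSup₂_le fun z hz => this hz
  · have := hcl hlim (F := {z | ENNReal.ofReal (dist (𝒳.π z.1) (𝒴.π z.2)) ≤ c})
      (isClosed_le (ENNReal.continuous_ofReal.comp
        ((𝒳.lipschitz.continuous.comp continuous_fst).dist
          (𝒴.lipschitz.continuous.comp continuous_snd))) continuous_const) fun k => hπ (ψ k)
    exact iSup₂_le fun z hz => this hz

variable [CompleteSpace X] [MeasurableSpace B] [BorelSpace B] [SecondCountableTopology B]
  [CompleteSpace B]

/-- If the Wasserstein distance is below `c'`, then there are sequences outside given sets of small
measure whose augmented distance matrices have distance less than `c`. -/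
theorem exists_rho_lt_of_wassersteinDist_lt (𝒳 : MMField X B) (𝒴 : MMField Y B) {p : ℝ≥0∞}
    (hp : 1 ≤ p) {ι κ : Type*} [Countable ι] [Countable κ] {e : κ → ι} (he : Function.Injective e)
    {c c' δ : ℝ≥0∞} (hc : c ≠ 0) (hc' : c ≠ ∞) (hδ : c' / c + δ + δ < 1)
    (h : wassersteinDist ADM.rho p (𝒳.admLaw κ) (𝒴.admLaw κ) < c')
    {S : Set (ι → X)} (hS : Measure.infinitePi (fun _ : ι => (𝒳.μ : Measure X)) S ≤ δ)
    {T : Set (ι → Y)} (hT : Measure.infinitePi (fun _ : ι => (𝒴.μ : Measure Y)) T ≤ δ) :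
    ∃ x ∉ S, ∃ y ∉ T,
      ADM.rho (𝒳.admMap κ fun i => x (e i)) (𝒴.admMap κ fun i => y (e i)) < c := by
  simp only [wassersteinDist, iInf_lt_iff] at h
  obtain ⟨Q, hQ, hlt⟩ := h
  have hx : Measurable fun x : ι → X => 𝒳.admMap κ fun i => x (e i) :=
    (𝒳.measurable_admMap κ).comp (by fun_prop)
  have hy : Measurable fun y : ι → Y => 𝒴.admMap κ fun i => y (e i) :=
    (𝒴.measurable_admMap κ).comp (by fun_prop)
  -- Writing the law as an image from `ι → X` makes the lifted coupling live on the full families,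
  -- where `S` and `T` live.
  have hx' : 𝒳.admLaw κ = (Measure.infinitePi fun _ : ι => (𝒳.μ : Measure X)).map
      fun x => 𝒳.admMap κ fun i => x (e i) := by
    rw [← map_reindex_admLaw 𝒳 he, admLaw,
      Measure.map_map (ADM.measurable_reindex e) (𝒳.measurable_admMap ι)]
    rfl
  have hy' : 𝒴.admLaw κ = (Measure.infinitePi fun _ : ι => (𝒴.μ : Measure Y)).map
      fun y => 𝒴.admMap κ fun i => y (e i) := by
    rw [← map_reindex_admLaw 𝒴 he, admLaw,
      Measure.map_map (ADM.measurable_reindex e) (𝒴.measurable_admMap ι)]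
    rfl
  rw [hx', hy'] at hQ
  obtain ⟨Q', hQ', rfl⟩ := hQ.exists_map_eq hx hy
  have hQp := hQ'.isProbabilityMeasure
  rw [eLpNorm_map_measure ADM.measurable_rho.aestronglyMeasurable (hx.prodMap hy).aemeasurable]
    at hlt
  have hρ := ADM.measurable_rho.comp (hx.prodMap hy)
  have h₁ := (eLpNorm_le_eLpNorm_of_exponent_le hp hρ.aestronglyMeasurable).trans_lt hlt
  rw [eLpNorm_one_eq_lintegral_enorm] at h₁
  simp only [enorm_eq_self] at h₁
  -- Markov's inequality, after lowering the exponent to `1`.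
  have hA := (ENNReal.le_div_iff_mul_le (Or.inl hc) (Or.inl hc')).2
    ((mul_comm _ _).trans_le ((mul_meas_ge_le_lintegral hρ c).trans h₁.le))
  have hS' : Q' (Prod.fst ⁻¹' S) ≤ δ := by
    -- This inequality holds for arbitrary sets, so `S` may be non-measurable.
    refine (Measure.le_map_apply measurable_fst.aemeasurable S).trans ?_
    rwa [hQ'.1]
  have hT' : Q' (Prod.snd ⁻¹' T) ≤ δ := by
    refine (Measure.le_map_apply measurable_snd.aemeasurable T).trans ?_
    rwa [hQ'.2]
  by_contra! hcon
  refine (measure_univ (μ := Q')).not_lt (lt_of_le_of_lt ?_ hδ)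
  refine (measure_mono fun z _ => ?_).trans ((measure_union_le _ _).trans
    (add_le_add ((measure_union_le _ _).trans (add_le_add hA hS')) hT'))
  by_cases hzS : z.1 ∈ S
  · exact Or.inl (Or.inr hzS)
  by_cases hzT : z.2 ∈ T
  · exact Or.inr hzT
  exact Or.inl (Or.inl (hcon z.1 hzS z.2 hzT))

variable [CompleteSpace Y]

theorem gwDistInfty_le_of_frequently_wassersteinDist_lt (𝒳 : MMField X B) (𝒴 : MMField Y B)
    {p : ℝ≥0∞} (hp : 1 ≤ p) {c c' : ℝ≥0∞} (hcc' : c' < c) (hc : c ≠ ∞)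
    (h : ∃ᶠ n : ℕ in atTop,
      wassersteinDist ADM.rho p (𝒳.admLaw (Fin (n + 1))) (𝒴.admLaw (Fin (n + 1))) < c') :
    𝒳.gwDistInfty 𝒴 ≤ c := by
  obtain ⟨φ, hφ, hlt⟩ := extraction_of_frequently_atTop h
  have hc0 : c ≠ 0 := (bot_le.trans_lt hcc').ne'
  have hr : c' / c < 1 := by
    rw [ENNReal.div_lt_iff (Or.inl hc0) (Or.inl hc), one_mul]
    exact hcc'
  have hr' : 1 - c' / c ≠ 0 := (tsub_pos_of_lt hr).ne'
  -- Two exceptional sets of measure `δ` use up only half of the probability that Markov leaves.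
  let δ := (1 - c' / c) / 2 / 2
  have hδ0 : δ ≠ 0 := (ENNReal.half_pos (ENNReal.half_pos hr').ne').ne'
  have hδ : c' / c + δ + δ < 1 := by
    rw [add_assoc, ENNReal.add_halves]
    calc c' / c + (1 - c' / c) / 2 < c' / c + (1 - c' / c) :=
          ENNReal.add_lt_add_left hr.ne_top
            (ENNReal.half_lt_self hr' (ne_top_of_le_ne_top ENNReal.one_ne_top tsub_le_self))
      _ = 1 := add_tsub_cancel_of_le hr.le
  obtain ⟨S, hS, hSlim⟩ := exists_measure_le_and_tendsto_empiricalMeasure 𝒳.μ hδ0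
  obtain ⟨T, hT, hTlim⟩ := exists_measure_le_and_tendsto_empiricalMeasure 𝒴.μ hδ0
  have key (k : ℕ) := exists_rho_lt_of_wassersteinDist_lt 𝒳 𝒴 hp
    (e := fun i : Fin (φ k + 1) => (i : ℕ)) Fin.val_injective hc0 hc hδ (hlt k) hS hT
  choose x hx y hy hxy using key
  obtain ⟨hx₁, hx₂⟩ := hSlim x φ hx hφ.tendsto_atTop
  obtain ⟨hy₁, hy₂⟩ := hTlim y φ hy hφ.tendsto_atTop
  -- Not a coupling of the two fields: its marginals are the empirical measures of `x k` and `y k`,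
  -- which converge to the right ones.
  let P (k : ℕ) : ProbabilityMeasure (X × Y) := empiricalMeasure (φ k) fun i => (x k i, y k i)
  have hfst (k : ℕ) : (P k : Measure (X × Y)).map Prod.fst = empiricalMeasure (φ k) (x k) :=
    empiricalMeasure_map _ _ measurable_fst
  have hsnd (k : ℕ) : (P k : Measure (X × Y)).map Prod.snd = empiricalMeasure (φ k) (y k) :=
    empiricalMeasure_map _ _ measurable_snd
  have hle (k : ℕ) := ADM.rho_le_iff.1 (hxy k).le
  have hae (k : ℕ) : ∀ᵐ z ∂(P k : Measure (X × Y)), ∃ i ≤ φ k, z = (x k i, y k i) := by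
    have hfin : Set.Finite {z : X × Y | ∃ i ≤ φ k, z = (x k i, y k i)} :=
      ((Set.finite_Iic (φ k)).image fun i => (x k i, y k i)).subset
        fun z ⟨i, hi, hz⟩ => ⟨i, hi, hz.symm⟩
    exact (mem_ae_iff_prob_eq_one hfin.measurableSet).2
      (empiricalMeasure_apply_eq_one hfin.measurableSet fun i hi => ⟨i, hi, rfl⟩)
  refine gwDistInfty_le_of_isTightMeasureSet 𝒳 𝒴 (P := P) ?_ ?_ ?_ (fun k => ?_) fun k => ?_
  · refine IsTightMeasureSet.prodMk ?_ ?_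
    · rw [← Set.range_comp]
      convert hx₂ using 2
      exact funext hfst
    · rw [← Set.range_comp]
      convert hy₂ using 2
      exact funext hsnd
  · exact hx₁.congr fun k => Subtype.ext (hfst k).symm
  · exact hy₁.congr fun k => Subtype.ext (hsnd k).symm
  · have h₁ := Measure.quasiMeasurePreserving_fst (μ := (P k : Measure (X × Y)))
      (ν := (P k : Measure (X × Y))) |>.ae (hae k)
    have h₂ := Measure.quasiMeasurePreserving_snd (μ := (P k : Measure (X × Y)))
      (ν := (P k : Measure (X × Y))) |>.ae (hae k)
    filter_upwards [h₁, h₂] with z ⟨i, hi, hz₁⟩ ⟨j, hj, hz₂⟩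
    rw [hz₁, hz₂]
    exact (hle k).1 ⟨i, Nat.lt_succ_iff.2 hi⟩ ⟨j, Nat.lt_succ_iff.2 hj⟩
  · filter_upwards [hae k] with z ⟨i, hi, hz⟩
    rw [hz]
    exact (hle k).2 ⟨i, Nat.lt_succ_iff.2 hi⟩

theorem tendsto_wassersteinDist_admLaw (𝒳 : MMField X B) (𝒴 : MMField Y B) {p : ℝ≥0∞}
    (hp : 1 ≤ p) :
    Tendsto (fun n : ℕ => wassersteinDist ADM.rho p (𝒳.admLaw (Fin n)) (𝒴.admLaw (Fin n))) atTop
      (𝓝 (𝒳.gwDistInfty 𝒴)) := by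
  -- Matrices of size `n + 1` match `empiricalMeasure n`.
  rw [← tendsto_add_atTop_iff_nat 1]
  refine tendsto_order.2 ⟨fun a ha => ?_, fun a ha => .of_forall fun n =>
    (wassersteinDist_admLaw_le_gwDistInfty 𝒳 𝒴 p _).trans_lt ha⟩
  by_contra hcon
  obtain ⟨c, hac, hc⟩ := exists_between ha
  obtain ⟨c', hac', hc'⟩ := exists_between hac
  refine hc.not_ge (gwDistInfty_le_of_frequently_wassersteinDist_lt 𝒳 𝒴 hp hc' hc.ne_top ?_)
  exact (not_eventually.1 hcon).mono fun n hn => (not_lt.1 hn).trans_lt hac'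

end Lower

end MMField

/-! ### The main theorem. -/

theorem mainTheorem8 {X Y B : Type*}
    [MetricSpace X] [CompleteSpace X] [SecondCountableTopology X]
    [MeasurableSpace X] [BorelSpace X]
    [MetricSpace Y] [CompleteSpace Y] [SecondCountableTopology Y]
    [MeasurableSpace Y] [BorelSpace Y]
    [MetricSpace B] [CompleteSpace B] [SecondCountableTopology B]
    [MeasurableSpace B] [BorelSpace B]
    (𝒳 : MMField X B) (𝒴 : MMField Y B)
    (hX : Bornology.IsBounded (Set.univ : Set X)) (hY : Bornology.IsBounded (Set.univ : Set Y))
    (p : ℝ≥0∞) (hp : 1 ≤ p) :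
    Tendsto (fun n : ℕ => wassersteinDist ADM.rho p (𝒳.admDistFin n) (𝒴.admDistFin n)) atTop
        (𝓝 (wassersteinDist ADM.rho p 𝒳.admDist 𝒴.admDist)) ∧
      wassersteinDist ADM.rho p 𝒳.admDist 𝒴.admDist = 𝒳.gwDistInfty 𝒴 ∧
      𝒳.gwDistInfty 𝒴 < ∞ := by
  have htend := MMField.tendsto_wassersteinDist_admLaw 𝒳 𝒴 hp
  have heq : wassersteinDist ADM.rho p 𝒳.admDist 𝒴.admDist = 𝒳.gwDistInfty 𝒴 :=
    le_antisymm (MMField.wassersteinDist_admLaw_le_gwDistInfty 𝒳 𝒴 p ℕ)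
      -- The finite distances tend to the Gromov–Wasserstein distance and never exceed the infinite
      -- one.
      (le_of_tendsto' htend fun n =>
        MMField.wassersteinDist_admLaw_mono 𝒳 𝒴 p (e := fun i : Fin n => (i : ℕ)) Fin.val_injective)
  refine ⟨?_, heq, 𝒳.gwDistInfty_lt_top 𝒴 hX hY⟩
  simp only [MMField.admDistFin_eq_admLaw, heq]
  exact htend
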